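/- Let $A=(a_k)_{k\in\mathbb Z}$ and $B=(b_k)_{k\in\mathbb Z}$ be sequences of complex numbers with $a_k=o(|k|^{\alpha})$ and $b_k=o(|k|^{\beta})$ as $k\to\pm\infty$, where $\alpha,\beta<1$ are real. Infinite sums are limits of partial sums. For integers $j\ge1$, $n\ge 1$ and for $C=(c_k)\in\{A,B\}$ define $$D^{(C)}(j)=\sum_{k\ge1}\frac{c_k}{k^j}\ (j>1),\qquad D^{(C)}(1)=0,$$ $$\hat t^{(C)}(1)=\sum_{k\ge1}\Big(\frac{c_{k-1}}{k-1/2}-\frac{c_k}{k}\Big),\qquad \hat t^{(C)}(j)=\sum_{k\ge1}\frac{c_{k-1}}{(k-1/2)^j}\ (j>1),$$ $$\hat E^{(C)}_n(j)=\sum_{k=1}^{n}\frac{c_{n-k}}{(k-1/2)^j},\qquad \tilde E^{(C)}_n(j)=\sum_{k=1}^{n}\frac{c_{k-n-1}}{(k-1/2)^j},\qquad \hat E^{(C)}_0(j)=\tilde E^{(C)}_0(j)=0,$$ and, for $n\ge 0$, $$\hat F^{(C)}_n(1)=\sum_{k\ge1}\Big(\frac{c_{k+n}}{k-1/2}-\frac{c_k}{k}\Big),\qquad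 \hat F^{(C)}_n(j)=\sum_{k\ge1}\frac{c_{k+n}}{(k-1/2)^j}\ (j>1),$$ $$\tilde F^{(C)}_n(1)=\sum_{k\ge1}\Big(\frac{c_{k-n}}{k-1/2}-\frac{c_k}{k}\Big),\qquad \tilde F^{(C)}_n(j)=\sum_{k\ge1}\frac{c_{k-n}}{(k-1/2)^j}\ (j>1).$$ For $n\ge1$ put $$N^{(C)}_n(j)=\hat E^{(C)}_n(j)+(-1)^j\hat F^{(C)}_{n-1}(j),\qquad \bar N^{(C)}_n(j)=\tilde F^{(C)}_n(j)-\tilde E^{(C)}_{n-1}(j),$$ $$S^{(C)}_n(j)=N^{(C)}_n(j)+\bar N^{(C)}_n(j)-\frac{c_0}{(n-1/2)^j}.$$ Let $p>0$ and $q>1$ be integers, and suppose that $\alpha+\beta<q-1$ (which is automatic if $q\ge3$). Then all the series above converge, the sums over $n$ below converge absolutely, and $$\begin{aligned} &(-1)^{p+q}\sum_{n=1}^\infty\frac{\bar N^{(B)}_{n+1}(p)}{n^q}a_n+\sum_{n=1}^\infty\frac{N^{(B)}_n(p)}{n^q}a_n\\ &-(-1)^p\sum_{k=0}^{p-1}\binom{p+q-k-2}{q-1}\sum_{n=1}^\infty\frac{b_{n-1}S^{(A)}_n(k+1)}{(n-1/2)^{p+q-k-1}}\\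 &+a_0(-1)^p\binom{p+q-1}{q}\hat t^{(B)}(p+q)\\ &-2(-1)^p\sum_{j=1}^{\lfloor q/2\rfloor}\binom{p+q-2j-1}{p-1}D^{(A)}(2j)\,\hat t^{(B)}(p+q-2j)=0. \end{aligned}$$ -/

import Mathlib

open scoped BigOperators

noncomputable section

namespace ParametricEuler

/-- The bi-infinite complex sequence `a` satisfies `a_k = o(|k|^α)` as `k → ±∞`. -/
def GrowthLittleO (a : ℤ → ℂ) (α : ℝ) : Prop :=
  Asymptotics.IsLittleO (Filter.atTop ⊔ Filter.atBot : Filter ℤ) a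
    (fun k : ℤ => |(k : ℝ)| ^ α)

/-- The value of the series `∑_{k ≥ 1} f k`, the limit of its partial sums `∑_{k=1}^K f k`
(several series below converge only conditionally). The value `f 0` plays no role. -/
def series (f : ℕ → ℂ) : ℂ :=
  tsum (fun m : ℕ => f (m + 1)) (SummationFilter.conditional ℕ)

/-- The partial sums of the series `∑_{k ≥ 1} f k` converge. -/
def SeriesConverges (f : ℕ → ℂ) : Prop :=
  Summable (fun m : ℕ => f (m + 1)) (SummationFilter.conditional ℕ)

/-- The `k`-th term (`k ≥ 1`) of the series `D^{(A)}(j)`, for `j > 1`. -/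
def dTerm (a : ℤ → ℂ) (j k : ℕ) : ℂ := a k / (k : ℂ) ^ j

/-- `D^{(A)}(j) = ∑_{k ≥ 1} a_k / k^j` for `j > 1`, and `D^{(A)}(1) = 0`. -/
def D (a : ℤ → ℂ) (j : ℕ) : ℂ := if j = 1 then 0 else series (dTerm a j)

/-- The `k`-th term of the series `t̂^{(A)}(j)`; for `j = 1` it is
`a_{k-1}/(k-1/2) - a_k/k`, for `j > 1` it is `a_{k-1}/(k-1/2)^j`. -/
def tHatTerm (a : ℤ → ℂ) (j k : ℕ) : ℂ :=
  if j = 1 then a ((k : ℤ) - 1) / ((k : ℂ) - 1 / 2) - a k / (k : ℂ)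
  else a ((k : ℤ) - 1) / ((k : ℂ) - 1 / 2) ^ j

/-- `t̂^{(A)}(j)`, for `j ≥ 1`. -/
def tHat (a : ℤ → ℂ) (j : ℕ) : ℂ := series (tHatTerm a j)

/-- `Ê^{(A)}_n(j) = ∑_{k=1}^n a_{n-k}/(k-1/2)^j`. -/
def EHat (a : ℤ → ℂ) (n j : ℕ) : ℂ :=
  ∑ k ∈ Finset.Icc 1 n, a ((n : ℤ) - k) / ((k : ℂ) - 1 / 2) ^ j

/-- `Ẽ^{(A)}_n(j) = ∑_{k=1}^n a_{k-n-1}/(k-1/2)^j`. -/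
def ETilde (a : ℤ → ℂ) (n j : ℕ) : ℂ :=
  ∑ k ∈ Finset.Icc 1 n, a ((k : ℤ) - n - 1) / ((k : ℂ) - 1 / 2) ^ j

/-- The `k`-th term of the series `F̂^{(A)}_n(j)`. -/
def FHatTerm (a : ℤ → ℂ) (n j k : ℕ) : ℂ :=
  if j = 1 then a ((k : ℤ) + n) / ((k : ℂ) - 1 / 2) - a k / (k : ℂ)
  else a ((k : ℤ) + n) / ((k : ℂ) - 1 / 2) ^ j

/-- `F̂^{(A)}_n(j)`, for `j ≥ 1`. -/
def FHat (a : ℤ → ℂ) (n j : ℕ) : ℂ := series (FHatTerm a n j)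

/-- The `k`-th term of the series `F̃^{(A)}_n(j)`. -/
def FTildeTerm (a : ℤ → ℂ) (n j k : ℕ) : ℂ :=
  if j = 1 then a ((k : ℤ) - n) / ((k : ℂ) - 1 / 2) - a k / (k : ℂ)
  else a ((k : ℤ) - n) / ((k : ℂ) - 1 / 2) ^ j

/-- `F̃^{(A)}_n(j)`, for `j ≥ 1`. -/
def FTilde (a : ℤ → ℂ) (n j : ℕ) : ℂ := series (FTildeTerm a n j)

/-- `N^{(A)}_n(j) = Ê^{(A)}_n(j) + (-1)^j F̂^{(A)}_{n-1}(j)`, for `n ≥ 1`. -/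
def N (a : ℤ → ℂ) (n j : ℕ) : ℂ := EHat a n j + (-1) ^ j * FHat a (n - 1) j

/-- `N̄^{(A)}_n(j) = F̃^{(A)}_n(j) - Ẽ^{(A)}_{n-1}(j)`, for `n ≥ 1`. -/
def NBar (a : ℤ → ℂ) (n j : ℕ) : ℂ := FTilde a n j - ETilde a (n - 1) j

/-- `S^{(A)}_n(j) = N^{(A)}_n(j) + N̄^{(A)}_n(j) - a_0/(n-1/2)^j`, for `n ≥ 1`. Up to the factor
`(-1)^(j-1)`, this is the coefficient of `(s-n+1/2)^(j-1)` in the Taylor expansion at `s = n-1/2`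
of `a_0/s - 2s ∑_{k ≥ 1} a_k/(k^2-s^2)`. -/
def S (a : ℤ → ℂ) (n j : ℕ) : ℂ :=
  N a n j + NBar a n j - a 0 / ((n : ℂ) - 1 / 2) ^ j

/-- The `n`-th term `N̄^{(B)}_{n+1}(p) a_n / n^q` of the first sum. -/
def barTerm (a b : ℤ → ℂ) (p q n : ℕ) : ℂ := NBar b (n + 1) p / (n : ℂ) ^ q * a n

/-- The `n`-th term `N^{(B)}_n(p) a_n / n^q` of the second sum. -/
def plainTerm (a b : ℤ → ℂ) (p q n : ℕ) : ℂ := N b n p / (n : ℂ) ^ q * a n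

/-- The `n`-th term `b_{n-1} S^{(A)}_n(k+1) / (n-1/2)^{p+q-k-1}` of the sums over half-integers,
for `k < p`. -/
def halfTerm (a b : ℤ → ℂ) (p q k n : ℕ) : ℂ :=
  b ((n : ℤ) - 1) * S a n (k + 1) / ((n : ℂ) - 1 / 2) ^ (p + q - k - 1)

end ParametricEuler

end

/-!
# A relation between Euler-type sums over integers and half-integers

Only the values `a_i`, `b_m` with `i, m ≥ 0` matter, and the relation is bilinear in them. Each of
`N`, `N̄`, `S` and `t̂` is an absolutely convergent sum `∑_m c_m K(n, m)` whose kernel `K` is built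
from `1/(n + 1/2 ± m)^j`, regularized by `∓1/m` when `j = 1` (`NBar_eq_tsum`, `N_eq_tsum`,
`S_eq_tsum`, `tHat_eq_tsum`). All these kernels are dominated by `(n+1) / ((m+1)(1+|n-m|))`, and
for nonnegative growth exponents `α, β < 1` with `α + β < q - 1` the resulting double series over
`(n, m)` converge absolutely (`summable_rpow_mul_domKer`). By Fubini, the relation therefore
follows from its coefficients at the single pairs `(a_i, b_m)`.

With `x = m + 1/2`, the coefficient at `i ≥ 1` is the sum of the residues of the rational function
`(x-s)^{-p} s^{-q} (1/(s-i) + 1/(s+i))`, up to sign. It vanishes by the classical partial fraction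
decomposition of `1/(u^p v^q)` for fixed `u + v`, applied to `(u, v) = (x - i, i)` and
`(x + i, -i)` (`residue_sum_eq_zero`); the regularizing terms cancel among themselves
(`kernel_relation`). The coefficient at `i = 0` vanishes by the hockey-stick identity
(`sum_choose_eq`).
-/

/-! ### The partial fraction identity -/

namespace ParametricEuler

open Finset

/-- Recurrence of the partial fraction coefficients: Pascal's rule in generating form. -/
lemma partialFraction_recurrence (U W : ℂ) (P Q : ℕ) :
    ∑ l ∈ range (P + 2), ((Q + 1 + l).choose l : ℂ) * (U ^ (P + 2 - l) * W ^ (Q + 2 + l)) =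
      W * ∑ l ∈ range (P + 2), ((Q + l).choose l : ℂ) * (U ^ (P + 2 - l) * W ^ (Q + 1 + l)) +
      W * ∑ l ∈ range (P + 1),
        ((Q + 1 + l).choose l : ℂ) * (U ^ (P + 1 - l) * W ^ (Q + 2 + l)) := by
  rw [sum_range_succ' _ (P + 1), sum_range_succ' _ (P + 1), mul_add, mul_sum, mul_sum,
    add_right_comm (Finset.sum _ _), ← sum_add_distrib]
  congr 1
  · refine sum_congr rfl fun l _ => ?_
    have h : (Q + 1 + (l + 1)).choose (l + 1)
        = (Q + 1 + l).choose l + (Q + (l + 1)).choose (l + 1) := by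
      rw [show Q + (l + 1) = Q + 1 + l by ring, ← Nat.choose_succ_succ]; rfl
    have h2 : P + 2 - (l + 1) = P + 1 - l := by omega
    rw [h, h2]
    push_cast
    ring
  · simp
    ring

lemma partialFraction_base (U V W : ℂ) (h : U * V = W * (U + V)) (Q : ℕ) :
    U * V ^ (Q + 1) = U * W ^ (Q + 1) + ∑ l ∈ range (Q + 1), V ^ (Q + 1 - l) * W ^ (1 + l) := by
  induction Q with
  | zero => simp; linear_combination h
  | succ Q ih =>
    rw [sum_range_succ']
    have h2 : ∀ l ∈ range (Q + 1), V ^ (Q + 1 + 1 - (l + 1)) * W ^ (1 + (l + 1)) =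
        W * (V ^ (Q + 1 - l) * W ^ (1 + l)) := fun l _ => by
      rw [show Q + 1 + 1 - (l + 1) = Q + 1 - l by omega]; ring
    rw [sum_congr rfl h2, ← mul_sum]
    simp only [Nat.sub_zero]
    linear_combination V ^ (Q + 1) * h + W * ih

/-- With `U = 1/u`, `V = 1/v`, `W = 1/(u+v)`, this is the partial fraction decomposition of
`1/(u^p v^q)` for fixed `u + v`; the relation between `U`, `V` and `W` is all that is used. -/
lemma partialFraction_aux (U V W : ℂ) (h : U * V = W * (U + V)) (P Q : ℕ) :
    U ^ (P + 1) * V ^ (Q + 1) =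
      ∑ l ∈ range (P + 1), ((Q + l).choose l : ℂ) * (U ^ (P + 1 - l) * W ^ (Q + 1 + l)) +
      ∑ l ∈ range (Q + 1), ((P + l).choose l : ℂ) * (V ^ (Q + 1 - l) * W ^ (P + 1 + l)) := by
  induction P generalizing Q with
  | zero => simpa using partialFraction_base U V W h Q
  | succ P ihP =>
    induction Q with
    | zero =>
      have := partialFraction_base V U W (by linear_combination h) (P + 1)
      simp only [zero_add, pow_one, range_one, sum_singleton, Nat.choose_zero_right, Nat.cast_one,
        Nat.sub_zero, add_zero, one_mul, Nat.choose_self] at this ⊢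
      linear_combination this
    | succ Q ihQ =>
      have h1 := ihP (Q + 1)
      have h2 := partialFraction_recurrence U W P Q
      have h3 := partialFraction_recurrence V W Q P
      simp only [add_assoc, Nat.reduceAdd] at *
      linear_combination U ^ (P + 1) * V ^ (Q + 1) * h + W * h1 + W * ihQ - h2 - h3

lemma partialFraction {u v : ℂ} (hu : u ≠ 0) (hv : v ≠ 0) (huv : u + v ≠ 0) {p q : ℕ}
    (hp : 0 < p) (hq : 0 < q) :
    1 / (u ^ p * v ^ q) =
      ∑ k ∈ range p, ((p + q - k - 2).choose (q - 1) : ℂ) *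
        (1 / u ^ (k + 1) / (u + v) ^ (p + q - k - 1)) +
      ∑ k ∈ range q, ((p + q - k - 2).choose (p - 1) : ℂ) *
        (1 / v ^ (k + 1) / (u + v) ^ (p + q - k - 1)) := by
  obtain ⟨P, rfl⟩ := Nat.exists_eq_add_of_lt hp
  obtain ⟨Q, rfl⟩ := Nat.exists_eq_add_of_lt hq
  have h := partialFraction_aux u⁻¹ v⁻¹ (u + v)⁻¹ (by field_simp; ring) P Q
  rw [← sum_range_reflect, ← sum_range_reflect (n := Q + 1)] at h
  simp only [zero_add]
  convert h using 1
  · rw [inv_pow, inv_pow, one_div, mul_inv]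
  congr 1
  · refine sum_congr rfl fun k hk => ?_
    have hk' := mem_range.1 hk
    have e1 : (P + 1 + (Q + 1) - k - 2).choose (Q + 1 - 1)
        = (Q + (P + 1 - 1 - k)).choose (P + 1 - 1 - k) := by
      rw [Nat.choose_symm_add.symm]; congr 1; omega
    have e2 : P + 1 - (P + 1 - 1 - k) = k + 1 := by omega
    have e3 : Q + 1 + (P + 1 - 1 - k) = P + 1 + (Q + 1) - k - 1 := by omega
    rw [e1, e2, e3, inv_pow, inv_pow, one_div, div_eq_mul_inv]
  · refine sum_congr rfl fun k hk => ?_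
    have hk' := mem_range.1 hk
    have e1 : (P + 1 + (Q + 1) - k - 2).choose (P + 1 - 1)
        = (P + (Q + 1 - 1 - k)).choose (Q + 1 - 1 - k) := by
      rw [Nat.choose_symm_add.symm]; congr 1; omega
    have e2 : Q + 1 - (Q + 1 - 1 - k) = k + 1 := by omega
    have e3 : P + 1 + (Q + 1 - 1 - k) = P + 1 + (Q + 1) - k - 1 := by omega
    rw [e1, e2, e3, inv_pow, inv_pow, one_div, div_eq_mul_inv]

lemma sum_range_even_part (g : ℕ → ℂ) (q : ℕ) :
    ∑ k ∈ range q, (1 + (-1) ^ (k + 1)) * g (k + 1) = 2 * ∑ j ∈ Icc 1 (q / 2), g (2 * j) := by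
  induction q with
  | zero => simp
  | succ q ih =>
    rw [sum_range_succ, ih]
    rcases Nat.even_or_odd' q with ⟨c, rfl | rfl⟩
    · rw [show 2 * c / 2 = c by omega, show (2 * c + 1) / 2 = c by omega]
      simp [pow_succ, pow_mul]
    · rw [show (2 * c + 1) / 2 = c by omega, show (2 * c + 1 + 1) / 2 = c + 1 by omega,
        sum_Icc_succ_top (by omega), show 2 * c + 1 + 1 = 2 * (c + 1) by ring, pow_mul]
      norm_num
      ring

/-- The vanishing of the sum of the residues of `(x-s)^{-p} s^{-q} (1/(s-y) + 1/(s+y))`. -/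
lemma residue_sum_eq_zero {x y : ℂ} (hx : x ≠ 0) (hy : y ≠ 0) (h1 : x - y ≠ 0) (h2 : x + y ≠ 0)
    {p q : ℕ} (hp : 0 < p) (hq : 0 < q) :
    (-1) ^ (p + q) * (1 / (x + y) ^ p / y ^ q) + 1 / (y - x) ^ p / y ^ q
      - (-1) ^ p * ∑ k ∈ range p, ((p + q - k - 2).choose (q - 1) : ℂ) *
          ((1 / (x - y) ^ (k + 1) + 1 / (x + y) ^ (k + 1)) / x ^ (p + q - k - 1))
      - 2 * (-1) ^ p * ∑ j ∈ Icc 1 (q / 2), ((p + q - 2 * j - 1).choose (p - 1) : ℂ) *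
          (1 / y ^ (2 * j) / x ^ (p + q - 2 * j)) = 0 := by
  have e1 := partialFraction (u := x - y) (v := y) h1 hy (by simpa using hx) hp hq
  have e2 := partialFraction (u := x + y) (v := -y) h2 (neg_ne_zero.2 hy) (by simpa using hx) hp hq
  have e3 := sum_range_even_part
    (fun k => ((p + q - k - 1).choose (p - 1) : ℂ) * (1 / y ^ k / x ^ (p + q - k))) q
  rw [show x - y + y = x by ring] at e1
  rw [show x + y + -y = x by ring] at e2
  have e4 : ∑ k ∈ range q, (1 + (-1 : ℂ) ^ (k + 1)) * (((p + q - (k + 1) - 1).choose (p - 1) : ℂ) *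
        (1 / y ^ (k + 1) / x ^ (p + q - (k + 1)))) =
      ∑ k ∈ range q, ((p + q - k - 2).choose (p - 1) : ℂ) *
        (1 / y ^ (k + 1) / x ^ (p + q - k - 1)) +
      ∑ k ∈ range q, ((p + q - k - 2).choose (p - 1) : ℂ) *
        (1 / (-y) ^ (k + 1) / x ^ (p + q - k - 1)) := by
    rw [← sum_add_distrib]
    refine sum_congr rfl fun k _ => ?_
    rw [show p + q - (k + 1) - 1 = p + q - k - 2 by omega,
      show p + q - (k + 1) = p + q - k - 1 by omega, neg_pow y]
    rcases neg_one_pow_eq_or ℂ (k + 1) with h | h <;> rw [h] <;> ring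
  have e5 : ∑ k ∈ range p, ((p + q - k - 2).choose (q - 1) : ℂ) *
          ((1 / (x - y) ^ (k + 1) + 1 / (x + y) ^ (k + 1)) / x ^ (p + q - k - 1)) =
      ∑ k ∈ range p, ((p + q - k - 2).choose (q - 1) : ℂ) *
          (1 / (x - y) ^ (k + 1) / x ^ (p + q - k - 1)) +
      ∑ k ∈ range p, ((p + q - k - 2).choose (q - 1) : ℂ) *
          (1 / (x + y) ^ (k + 1) / x ^ (p + q - k - 1)) := by
    rw [← sum_add_distrib]
    exact sum_congr rfl fun k _ => by ring
  have e6 : 1 / (y - x) ^ p / y ^ q = (-1) ^ p * (1 / ((x - y) ^ p * y ^ q)) := by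
    rw [show y - x = -(x - y) by ring, neg_pow (x - y)]
    rcases neg_one_pow_eq_or ℂ p with h | h <;> rw [h] <;> simp <;> ring
  have e7 : (-1) ^ (p + q) * (1 / (x + y) ^ p / y ^ q) =
      (-1) ^ p * (1 / ((x + y) ^ p * (-y) ^ q)) := by
    rw [neg_pow y, pow_add]
    rcases neg_one_pow_eq_or ℂ q with h | h <;> rw [h] <;> simp <;> ring
  rw [e4] at e3
  rw [e5, e6, e7]
  linear_combination (-1 : ℂ) ^ p * e1 + (-1 : ℂ) ^ p * e2 + (-1 : ℂ) ^ p * e3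

/-- The contribution of `a_0`: the hockey-stick identity. -/
lemma sum_choose_eq {p q : ℕ} (hq : 0 < q) :
    ∑ k ∈ range p, (p + q - k - 2).choose (q - 1) = (p + q - 1).choose q := by
  obtain ⟨Q, rfl⟩ := Nat.exists_eq_add_of_lt hq
  simp only [zero_add, Nat.add_sub_cancel]
  induction p with
  | zero => simp
  | succ p ih =>
    rw [sum_range_succ', show p + 1 + (Q + 1) - 1 = (p + Q) + 1 by omega, Nat.choose_succ_succ,
      show p + 1 + (Q + 1) - 0 - 2 = p + Q by omega, add_comm ((p + Q).choose Q),
      show p + Q = p + (Q + 1) - 1 by omega, ← ih]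
    congr 1
    exact sum_congr rfl fun k _ => by congr 1; omega

end ParametricEuler

/-! ### The dominating kernel -/

namespace ParametricEuler

open Finset Filter Topology

lemma rpow_neg_mul_rpow_neg_le {M V s t : ℝ} (hM : 0 < M) (hV : 0 < V) (hs : 0 ≤ s) (ht : 0 ≤ t) :
    M ^ (-s) * V ^ (-t) ≤ M ^ (-(s + t)) + V ^ (-(s + t)) := by
  rw [neg_add, Real.rpow_add hM, Real.rpow_add hV]
  rcases le_total M V with h | h
  · have := Real.rpow_le_rpow_of_nonpos hM h (neg_nonpos.2 ht)
    have h1 : 0 ≤ V ^ (-s) * V ^ (-t) := by positivity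
    nlinarith [Real.rpow_nonneg hM.le (-s)]
  · have := Real.rpow_le_rpow_of_nonpos hV h (neg_nonpos.2 hs)
    have h1 : 0 ≤ M ^ (-s) * M ^ (-t) := by positivity
    nlinarith [Real.rpow_nonneg hV.le (-t)]

lemma rpow_mul_div_le {X M V β ε : ℝ} (hX : 0 < X) (hM : 0 < M) (hV : 0 < V) (hXMV : X ≤ M + V)
    (hβ : 0 ≤ β) (hε : 0 ≤ ε) (hβε : β + ε ≤ 1) :
    M ^ β * (X / (M * V)) ≤ X ^ (β + ε) * (2 * (M ^ (-(1 + ε)) + V ^ (-(1 + ε)))) := by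
  -- Subadditivity of `t ↦ t ^ (1 - β - ε)` trades the surplus power of `X` for powers of `M`, `V`.
  have h1 : X ^ (1 - (β + ε)) ≤ M ^ (1 - (β + ε)) + V ^ (1 - (β + ε)) :=
    (Real.rpow_le_rpow hX.le hXMV (by linarith)).trans
      (Real.rpow_add_le_add_rpow hM.le hV.le (by linarith) (by linarith))
  have h2 := rpow_neg_mul_rpow_neg_le hM hV hε zero_le_one
  have h3 := rpow_neg_mul_rpow_neg_le (s := 1 - β) (t := β + ε) hM hV (by linarith) (by linarith)
  rw [add_comm ε] at h2
  rw [show 1 - β + (β + ε) = 1 + ε by ring] at h3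
  have e1 : M ^ β * (X / (M * V)) = X ^ (β + ε) * (X ^ (1 - (β + ε)) * (M ^ (β - 1) * V ^ (-1 : ℝ))) := by
    have hXX : X ^ (β + ε) * X ^ (1 - (β + ε)) = X := by
      rw [← Real.rpow_add hX]; simp
    rw [← mul_assoc, hXX, Real.rpow_sub_one hM.ne', Real.rpow_neg_one]
    field_simp
  have e2 : M ^ (1 - (β + ε)) * (M ^ (β - 1) * V ^ (-1 : ℝ)) = M ^ (-ε) * V ^ (-1 : ℝ) := by
    rw [← mul_assoc, ← Real.rpow_add hM]; ring_nf
  have e3 : V ^ (1 - (β + ε)) * (M ^ (β - 1) * V ^ (-1 : ℝ)) = M ^ (-(1 - β)) * V ^ (-(β + ε)) := by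
    rw [mul_left_comm, ← Real.rpow_add hV]; ring_nf
  rw [e1]
  refine mul_le_mul_of_nonneg_left ?_ (by positivity)
  calc X ^ (1 - (β + ε)) * (M ^ (β - 1) * V ^ (-1 : ℝ))
      ≤ (M ^ (1 - (β + ε)) + V ^ (1 - (β + ε))) * (M ^ (β - 1) * V ^ (-1 : ℝ)) := by gcongr
    _ ≤ _ := by rw [add_mul, e2, e3]; linarith

/-- The kernel `(n+1) / ((m+1)(1+|n-m|))`, which dominates all the kernels `1/(n+1/2 ± m)^j`
(regularized by `1/m` for `j = 1`) up to constants. -/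
noncomputable def domKer (n m : ℕ) : ℝ := ((n : ℝ) + 1) / (((m : ℝ) + 1) * (1 + |(n : ℝ) - m|))

lemma domKer_nonneg (n m : ℕ) : 0 ≤ domKer n m := by unfold domKer; positivity

lemma summable_nat_add_one_rpow_neg {t : ℝ} (ht : 1 < t) :
    Summable fun n : ℕ => ((n : ℝ) + 1) ^ (-t) := by
  have := (summable_nat_add_iff 1).2 (Real.summable_nat_rpow.2 (neg_lt_neg ht))
  simpa using this

lemma summable_one_add_abs_int_rpow_neg {t : ℝ} (ht : 1 < t) :
    Summable fun k : ℤ => (1 + |(k : ℝ)|) ^ (-t) := by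
  apply Summable.of_nat_of_neg <;> simpa [add_comm] using summable_nat_add_one_rpow_neg ht

lemma summable_rpow_mul_domKer {β s : ℝ} (hβ : 0 ≤ β) (hβ1 : β < 1) (hs : β + 1 < s) :
    Summable fun x : ℕ × ℕ => ((x.1 : ℝ) + 1) ^ (-s) * (((x.2 : ℝ) + 1) ^ β * domKer x.1 x.2) := by
  obtain ⟨ε, hε, hε1, hε2⟩ : ∃ ε : ℝ, 0 < ε ∧ β + ε ≤ 1 ∧ 1 < s - (β + ε) :=
    ⟨min (1 - β) ((s - β - 1) / 2), lt_min (by linarith) (by linarith),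
      by linarith [min_le_left (1 - β) ((s - β - 1) / 2)],
      by linarith [min_le_right (1 - β) ((s - β - 1) / 2)]⟩
  have hn := summable_nat_add_one_rpow_neg hε2
  have h1 : Summable fun x : ℕ × ℕ =>
      ((x.1 : ℝ) + 1) ^ (-(s - (β + ε))) * ((x.2 : ℝ) + 1) ^ (-(1 + ε)) :=
    hn.mul_of_nonneg (summable_nat_add_one_rpow_neg (by linarith))
      (fun n => by dsimp; positivity) (fun n => by dsimp; positivity)
  have h2 : Summable fun x : ℕ × ℕ =>
      ((x.1 : ℝ) + 1) ^ (-(s - (β + ε))) * (1 + |(x.1 : ℝ) - x.2|) ^ (-(1 + ε)) := by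
    have h := hn.mul_of_nonneg (summable_one_add_abs_int_rpow_neg (t := 1 + ε) (by linarith))
      (fun n => by dsimp; positivity) (fun n => by dsimp; positivity)
    have hinj : Function.Injective fun x : ℕ × ℕ => (x.1, (x.1 : ℤ) - x.2) := by
      rintro ⟨n, m⟩ ⟨n', m'⟩ h
      simp only [Prod.mk.injEq] at h ⊢
      omega
    simpa [Function.comp_def] using h.comp_injective hinj
  refine Summable.of_nonneg_of_le (fun x => ?_) (fun x => ?_) ((h1.add h2).mul_left 2)
  · have := domKer_nonneg x.1 x.2
    positivity
  · have hX : (0 : ℝ) < (x.1 : ℝ) + 1 := by positivity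
    have h := rpow_mul_div_le (X := (x.1 : ℝ) + 1) (M := (x.2 : ℝ) + 1)
      (V := 1 + |(x.1 : ℝ) - x.2|) hX (by positivity) (by positivity)
      (by linarith [le_abs_self ((x.1 : ℝ) - x.2)]) hβ hε.le hε1
    calc _ ≤ ((x.1 : ℝ) + 1) ^ (-s) * _ := mul_le_mul_of_nonneg_left h (by positivity)
      _ = _ := by
        rw [← mul_assoc, ← Real.rpow_add hX, show -s + (β + ε) = -(s - (β + ε)) by ring]
        ring

lemma summable_mul_mul_ker {β s C₁ C₂ C₃ : ℝ} (hβ : 0 ≤ β) (hβ1 : β < 1) (hs : β + 1 < s)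
    {u c : ℕ → ℂ} {K : ℕ → ℕ → ℂ} (hu : ∀ n : ℕ, ‖u n‖ ≤ C₁ * ((n : ℝ) + 1) ^ (-s))
    (hc : ∀ m : ℕ, ‖c m‖ ≤ C₂ * ((m : ℝ) + 1) ^ β) (hK : ∀ n m, ‖K n m‖ ≤ C₃ * domKer n m) :
    Summable fun x : ℕ × ℕ => u x.1 * (c x.2 * K x.1 x.2) := by
  refine Summable.of_norm_bounded
    ((summable_rpow_mul_domKer hβ hβ1 hs).mul_left (C₁ * (C₂ * C₃))) fun x => ?_
  rw [norm_mul, norm_mul]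
  have h := mul_le_mul (hu x.1) (mul_le_mul (hc x.2) (hK x.1 x.2) (norm_nonneg _)
    ((norm_nonneg _).trans (hc x.2))) (by positivity) ((norm_nonneg _).trans (hu x.1))
  refine h.trans_eq ?_
  ring

lemma summable_mul_ker {β C₂ C₃ : ℝ} (hβ : 0 ≤ β) (hβ1 : β < 1) {c : ℕ → ℂ} {K : ℕ → ℕ → ℂ}
    (hc : ∀ m : ℕ, ‖c m‖ ≤ C₂ * ((m : ℝ) + 1) ^ β) (hK : ∀ n m, ‖K n m‖ ≤ C₃ * domKer n m) (n : ℕ) :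
    Summable fun m => c m * K n m := by
  have h : Summable fun m : ℕ =>
      ((n : ℝ) + 1) ^ (-3 : ℝ) * (((m : ℝ) + 1) ^ β * domKer n m) :=
    (summable_rpow_mul_domKer hβ hβ1 (by linarith)).prod_factor n
  replace h := (summable_mul_left_iff (by positivity)).1 h
  refine Summable.of_norm_bounded (h.mul_left (C₂ * C₃)) fun m => ?_
  rw [norm_mul]
  refine (mul_le_mul (hc m) (hK n m) (norm_nonneg _) ((norm_nonneg _).trans (hc m))).trans_eq ?_
  ring

/-! ### The kernels of `N`, `N̄` and `S` -/

/-- The coefficient of `c_m` in `N̄^{(C)}_{n+1}(j)`. The regularizing term `1/m` equals `0` for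
`m = 0` by the convention `1 / 0 = 0`, as it should. -/
noncomputable def kerPlus (j n m : ℕ) : ℂ := 1 / ((n : ℂ) + 1 / 2 + m) ^ j - if j = 1 then 1 / (m : ℂ) else 0

/-- The coefficient of `c_m` in `N^{(C)}_{n+1}(j)`, with the same convention at `m = 0` as in
`kerPlus`. -/
noncomputable def kerMinus (j n m : ℕ) : ℂ := 1 / ((n : ℂ) + 1 / 2 - m) ^ j + if j = 1 then 1 / (m : ℂ) else 0

/-- The coefficient of `c_m` in `S^{(C)}_{n+1}(j)`. -/
noncomputable def kerSum (j n m : ℕ) : ℂ :=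
  kerMinus j n m + kerPlus j n m - if m = 0 then 1 / ((n : ℂ) + 1 / 2) ^ j else 0

lemma norm_nat_add_half (n : ℕ) : ‖(n : ℂ) + 1 / 2‖ = (n : ℝ) + 1 / 2 := by
  rw [show (n : ℂ) + 1 / 2 = (((n : ℝ) + 1 / 2 : ℝ) : ℂ) by push_cast; ring, Complex.norm_real,
    Real.norm_of_nonneg (by positivity)]

lemma norm_nat_add_half_add (n m : ℕ) : ‖(n : ℂ) + 1 / 2 + m‖ = (n : ℝ) + 1 / 2 + m := by
  rw [show (n : ℂ) + 1 / 2 + m = (((n : ℝ) + 1 / 2 + m : ℝ) : ℂ) by push_cast; ring,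
    Complex.norm_real, Real.norm_of_nonneg (by positivity)]

lemma norm_nat_add_half_sub (n m : ℕ) : ‖(n : ℂ) + 1 / 2 - m‖ = |(n : ℝ) + 1 / 2 - m| := by
  rw [show (n : ℂ) + 1 / 2 - m = (((n : ℝ) + 1 / 2 - m : ℝ) : ℂ) by push_cast; ring,
    Complex.norm_real, Real.norm_eq_abs]

lemma nat_add_half_ne_zero (n : ℕ) : (n : ℂ) + 1 / 2 ≠ 0 := by
  rw [← norm_pos_iff, norm_nat_add_half]; positivity

lemma nat_add_half_add_ne_zero (n m : ℕ) : (n : ℂ) + 1 / 2 + m ≠ 0 := by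
  rw [← norm_pos_iff, norm_nat_add_half_add]; positivity

lemma half_le_abs_sub (n m : ℕ) : 1 / 2 ≤ |(n : ℝ) + 1 / 2 - m| := by
  rcases le_or_gt m n with h | h
  · have h' : (m : ℝ) ≤ n := by exact_mod_cast h
    exact le_abs.2 (Or.inl (by linarith))
  · have h' : (n : ℝ) + 1 ≤ m := by exact_mod_cast h
    exact le_abs.2 (Or.inr (by linarith))

lemma nat_add_half_sub_ne_zero (n m : ℕ) : (n : ℂ) + 1 / 2 - m ≠ 0 := by
  rw [← norm_pos_iff, norm_nat_add_half_sub]; linarith [half_le_abs_sub n m]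

lemma one_add_abs_sub_le (n m : ℕ) : (1 + |(n : ℝ) - m|) / 4 ≤ |(n : ℝ) + 1 / 2 - m| := by
  have h1 := half_le_abs_sub n m
  have h2 : |(n : ℝ) - m| ≤ |(n : ℝ) + 1 / 2 - m| + 1 / 2 := by
    calc |(n : ℝ) - m| = |((n : ℝ) + 1 / 2 - m) + (-(1 / 2))| := by ring_nf
      _ ≤ _ := (abs_add_le _ _).trans_eq (by norm_num)
  linarith

lemma one_add_abs_sub_le_add (n m : ℕ) : (1 + |(n : ℝ) - m|) / 4 ≤ (n : ℝ) + 1 / 2 + m := by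
  have : |(n : ℝ) - m| ≤ n + m := abs_le.2 ⟨by linarith [(n.cast_nonneg : (0:ℝ) ≤ n)],
    by linarith [(m.cast_nonneg : (0:ℝ) ≤ m)]⟩
  linarith [(n.cast_nonneg : (0:ℝ) ≤ n), (m.cast_nonneg : (0:ℝ) ≤ m)]

/-- The bound for the unregularized kernels (`j ≥ 2`), from `m + 1 ≤ (n+1)(1+|n-m|)`. -/
lemma norm_one_div_pow_le {z : ℂ} {n m j : ℕ} (hj : 2 ≤ j) (hz : 1 / 2 ≤ ‖z‖)
    (hz' : (1 + |(n : ℝ) - m|) / 4 ≤ ‖z‖) : ‖1 / z ^ j‖ ≤ 2 ^ j * 4 * domKer n m := by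
  obtain ⟨i, rfl⟩ := Nat.exists_eq_add_of_le hj
  have hz0 : 0 < ‖z‖ := by linarith
  have hV : 0 < 1 + |(n : ℝ) - m| := by positivity
  have h1 : 1 / ‖z‖ ≤ 2 := by rw [div_le_iff₀ hz0]; linarith
  have h2 : 1 / ‖z‖ ≤ 4 / (1 + |(n : ℝ) - m|) := by
    rw [div_le_div_iff₀ hz0 hV]; linarith
  have h3 : 1 / (1 + |(n : ℝ) - m|) ≤ ((n : ℝ) + 1) / ((m : ℝ) + 1) := by
    rw [div_le_div_iff₀ hV (by positivity)]
    nlinarith [neg_abs_le ((n : ℝ) - m), mul_nonneg (n.cast_nonneg : (0:ℝ) ≤ n)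
      (abs_nonneg ((n : ℝ) - m))]
  rw [norm_div, norm_one, norm_pow, ← one_div_pow, pow_add, domKer]
  calc (1 / ‖z‖) ^ 2 * (1 / ‖z‖) ^ i
      ≤ (4 / (1 + |(n : ℝ) - m|)) ^ 2 * 2 ^ i := by gcongr
    _ = 2 ^ (2 + i) * 4 * (1 / (1 + |(n : ℝ) - m|) * (1 / (1 + |(n : ℝ) - m|))) := by
        rw [pow_add]; field_simp; ring
    _ ≤ 2 ^ (2 + i) * 4 * (((n : ℝ) + 1) / ((m : ℝ) + 1) * (1 / (1 + |(n : ℝ) - m|))) := by gcongr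
    _ = _ := by field_simp

/-- The bound for the regularized kernels (`j = 1`). -/
lemma norm_one_div_sub_one_div_le {x z : ℂ} {n m : ℕ} (hx : ‖x‖ ≤ n + 1) (hz0 : 1 / 2 ≤ ‖z‖)
    (hz : (1 + |(n : ℝ) - m|) / 4 ≤ ‖z‖) (hzx : z = x + m ∨ z = m - x) :
    ‖1 / z - 1 / (m : ℂ)‖ ≤ 8 * domKer n m := by
  have hz1 : 0 < ‖z‖ := by linarith
  have hV : 0 < 1 + |(n : ℝ) - m| := by positivity
  unfold domKer
  rcases m.eq_zero_or_pos with rfl | hm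
  · simp only [Nat.cast_zero, div_zero, sub_zero, zero_add, one_mul, norm_div, norm_one]
    rw [abs_of_nonneg n.cast_nonneg, add_comm 1 (n : ℝ), div_self (by positivity),
      div_le_iff₀ hz1]
    linarith
  · have hm' : (1 : ℝ) ≤ m := by exact_mod_cast hm
    have hm0 : (m : ℂ) ≠ 0 := by exact_mod_cast hm.ne'
    have e : ‖1 / z - 1 / (m : ℂ)‖ = ‖x‖ / (‖z‖ * m) := by
      rw [div_sub_div _ _ (norm_pos_iff.1 hz1) hm0, norm_div, norm_mul, Complex.norm_natCast]
      congr 1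
      rcases hzx with rfl | rfl
      · rw [← norm_neg]; ring_nf
      · ring_nf
    rw [e, ← mul_div_assoc, div_le_div_iff₀ (by positivity) (by positivity)]
    have h1 : ((m : ℝ) + 1) * (1 + |(n : ℝ) - m|) ≤ (2 * m) * (4 * ‖z‖) := by
      gcongr <;> linarith
    calc ‖x‖ * (((m : ℝ) + 1) * (1 + |(n : ℝ) - m|)) ≤ (n + 1) * ((2 * m) * (4 * ‖z‖)) := by gcongr
      _ = _ := by ring

lemma norm_kerPlus_le {j : ℕ} (hj : 0 < j) (n m : ℕ) :
    ‖kerPlus j n m‖ ≤ 2 ^ j * 4 * domKer n m := by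
  have h0 : 1 / 2 ≤ ‖(n : ℂ) + 1 / 2 + m‖ := by
    rw [norm_nat_add_half_add]; linarith [(n.cast_nonneg : (0:ℝ) ≤ n), (m.cast_nonneg : (0:ℝ) ≤ m)]
  have h1 : (1 + |(n : ℝ) - m|) / 4 ≤ ‖(n : ℂ) + 1 / 2 + m‖ := by
    rw [norm_nat_add_half_add]; exact one_add_abs_sub_le_add n m
  unfold kerPlus
  rcases (show j = 1 ∨ 2 ≤ j by omega) with rfl | hj
  · have := norm_one_div_sub_one_div_le (x := (n : ℂ) + 1 / 2)
      (by rw [norm_nat_add_half]; linarith) h0 h1 (Or.inl rfl)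
    rw [if_pos rfl, pow_one]
    linarith
  · rw [if_neg (by omega), sub_zero]
    exact norm_one_div_pow_le hj h0 h1

lemma norm_kerMinus_le {j : ℕ} (hj : 0 < j) (n m : ℕ) :
    ‖kerMinus j n m‖ ≤ 2 ^ j * 4 * domKer n m := by
  have h0 : 1 / 2 ≤ ‖(n : ℂ) + 1 / 2 - m‖ := by
    rw [norm_nat_add_half_sub]; exact half_le_abs_sub n m
  have h1 : (1 + |(n : ℝ) - m|) / 4 ≤ ‖(n : ℂ) + 1 / 2 - m‖ := by
    rw [norm_nat_add_half_sub]; exact one_add_abs_sub_le n m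
  unfold kerMinus
  rcases (show j = 1 ∨ 2 ≤ j by omega) with rfl | hj
  · have := norm_one_div_sub_one_div_le (n := n) (x := (n : ℂ) + 1 / 2)
      (z := (m : ℂ) - (n + 1 / 2))
      (by rw [norm_nat_add_half]; linarith) (by rwa [norm_sub_rev]) (by rwa [norm_sub_rev])
      (Or.inr rfl)
    rw [if_pos rfl, pow_one, ← norm_neg]
    have e : -(1 / ((n : ℂ) + 1 / 2 - m) + 1 / (m : ℂ)) =
        1 / ((m : ℂ) - (n + 1 / 2)) - 1 / (m : ℂ) := by
      rw [← neg_sub ((n : ℂ) + 1 / 2), one_div_neg_eq_neg_one_div]; ring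
    rw [e]
    linarith
  · rw [if_neg (by omega), add_zero]
    exact norm_one_div_pow_le hj h0 h1

lemma norm_kerSum_le {j : ℕ} (hj : 0 < j) (n m : ℕ) :
    ‖kerSum j n m‖ ≤ 2 ^ j * 9 * domKer n m := by
  have h1 := norm_kerPlus_le hj n m
  have h2 := norm_kerMinus_le hj n m
  have h3 : ‖if m = 0 then 1 / ((n : ℂ) + 1 / 2) ^ j else 0‖ ≤ 2 ^ j * domKer n m := by
    split_ifs with h
    · subst h
      have e : domKer n 0 = 1 := by
        unfold domKer
        rw [Nat.cast_zero, sub_zero, abs_of_nonneg n.cast_nonneg]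
        field_simp
        ring
      rw [e, mul_one, norm_div, norm_one, norm_pow, norm_nat_add_half, ← one_div_pow]
      gcongr
      rw [div_le_iff₀ (by positivity)]
      linarith [(n.cast_nonneg : (0:ℝ) ≤ n)]
    · simpa using mul_nonneg (by positivity : (0 : ℝ) ≤ 2 ^ j) (domKer_nonneg n m)
  unfold kerSum
  refine (norm_sub_le _ _).trans ((add_le_add (norm_add_le _ _) le_rfl).trans ?_)
  linarith

lemma kerSum_zero {j : ℕ} (n : ℕ) : kerSum j n 0 = 1 / ((n : ℂ) + 1 / 2) ^ j := by
  simp [kerSum, kerMinus, kerPlus]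

lemma kerSum_succ {j : ℕ} (n m : ℕ) : kerSum j n (m + 1) =
    1 / ((n : ℂ) + 1 / 2 - (m + 1 : ℕ)) ^ j + 1 / ((n : ℂ) + 1 / 2 + (m + 1 : ℕ)) ^ j := by
  simp only [kerSum, kerMinus, kerPlus, Nat.succ_ne_zero, if_false]
  ring

/-! ### The growth condition -/

lemma GrowthLittleO.exists_bound {c : ℤ → ℂ} {γ γ' : ℝ} (hc : GrowthLittleO c γ) (h : γ ≤ γ')
    (h0 : 0 ≤ γ') :
    ∃ C : ℝ, 0 ≤ C ∧ ∀ m : ℕ, ‖c m‖ ≤ C * ((m : ℝ) + 1) ^ γ' := by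
  have h1 : (fun m : ℕ => c m) =O[atTop] fun m : ℕ => ((m : ℝ) + 1) ^ γ' := by
    have hO := ((hc.mono le_sup_left).isBigO.comp_tendsto tendsto_natCast_atTop_atTop)
    refine hO.trans (Asymptotics.IsBigO.of_bound 1 ?_)
    filter_upwards [eventually_ge_atTop 1] with m hm
    have hm' : (1 : ℝ) ≤ m := by exact_mod_cast hm
    simp only [Function.comp_apply, Int.cast_natCast, Nat.abs_cast, one_mul]
    rw [Real.norm_of_nonneg (by positivity), Real.norm_of_nonneg (by positivity)]
    exact (Real.rpow_le_rpow_of_exponent_le hm' h).trans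
      (Real.rpow_le_rpow (by positivity) (by linarith) h0)
  obtain ⟨C, hC, hb⟩ := Asymptotics.bound_of_isBigO_nat_atTop h1
  refine ⟨C, hC.le, fun m => ?_⟩
  have hpos : 0 < ((m : ℝ) + 1) ^ γ' := by positivity
  simpa [abs_of_pos hpos] using hb hpos.ne'

end ParametricEuler

/-! ### The series as absolutely convergent sums over the kernels -/

namespace ParametricEuler

open Finset Filter Topology

lemma hasSum_conditional_of_tendsto {f : ℕ → ℂ} {s : ℂ}
    (h : Tendsto (fun K => ∑ k ∈ range K, f (k + 1)) atTop (𝓝 s)) :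
    HasSum (fun k => f (k + 1)) s (SummationFilter.conditional ℕ) := by
  rw [HasSum, SummationFilter.conditional_filter_eq_map_range, tendsto_map'_iff]
  exact h

lemma series_eq_of_tendsto {f : ℕ → ℂ} {s : ℂ}
    (h : Tendsto (fun K => ∑ k ∈ range K, f (k + 1)) atTop (𝓝 s)) : series f = s :=
  (hasSum_conditional_of_tendsto h).tsum_eq

lemma seriesConverges_of_tendsto {f : ℕ → ℂ} {s : ℂ}
    (h : Tendsto (fun K => ∑ k ∈ range K, f (k + 1)) atTop (𝓝 s)) : SeriesConverges f :=
  (hasSum_conditional_of_tendsto h).summable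

lemma series_eq_tsum {f : ℕ → ℂ} (h : Summable fun k => f (k + 1)) :
    series f = ∑' k, f (k + 1) :=
  series_eq_of_tendsto h.hasSum.tendsto_sum_nat

lemma seriesConverges_of_summable {f : ℕ → ℂ} (h : Summable fun k => f (k + 1)) :
    SeriesConverges f :=
  seriesConverges_of_tendsto h.hasSum.tendsto_sum_nat

section

variable {c : ℤ → ℂ}

lemma sum_Icc_one_eq_sum_range (g : ℕ → ℂ) (n : ℕ) :
    ∑ k ∈ Icc 1 n, g k = ∑ k ∈ range n, g (k + 1) := by
  induction n with
  | zero => simp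
  | succ n ih => rw [sum_Icc_succ_top (by omega), sum_range_succ, ih]

lemma sum_range_succ_div (g : ℕ → ℂ) (K : ℕ) :
    ∑ k ∈ range K, g (k + 1) / ((k + 1 : ℕ) : ℂ) = ∑ k ∈ range (K + 1), g k / (k : ℂ) := by
  rw [sum_range_succ']; simp

/-- The upper limits of the main and of the regularizing sum differ by a shift; for `j = 1` this
leaves a sum of boundedly many terms `c_k/k` with large `k`. -/
lemma sum_range_FTildeTerm (i j L : ℕ) :
    ∑ k ∈ range (L + i), FTildeTerm c (i + 1) j (k + 1) =
      ETilde c i j + ∑ m ∈ range L, c m * kerPlus j i m -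
        if j = 1 then ∑ r ∈ range (i + 1), c ((L + r : ℕ) : ℤ) / ((L + r : ℕ) : ℂ) else 0 := by
  have e1 : ∀ k, FTildeTerm c (i + 1) j (k + 1) = c ((k : ℤ) - i) / ((k : ℂ) + 1 / 2) ^ j -
      if j = 1 then c ((k + 1 : ℕ) : ℤ) / ((k + 1 : ℕ) : ℂ) else 0 := by
    intro k
    have e : ((k + 1 : ℕ) : ℂ) - 1 / 2 = (k : ℂ) + 1 / 2 := by push_cast; ring
    have e' : ((k + 1 : ℕ) : ℤ) - ((i + 1 : ℕ) : ℤ) = (k : ℤ) - i := by push_cast; ring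
    unfold FTildeTerm
    split_ifs with h
    · rw [h, pow_one, e, e']
    · rw [e, e', sub_zero]
  have e2 : ETilde c i j = ∑ k ∈ range i, c ((k : ℤ) - i) / ((k : ℂ) + 1 / 2) ^ j := by
    unfold ETilde
    rw [sum_Icc_one_eq_sum_range]
    refine sum_congr rfl fun k _ => ?_
    congr 2
    · push_cast; ring
    · push_cast; ring
  have e3 : ∀ m : ℕ, c m * kerPlus j i m = 
      c (((i + m : ℕ) : ℤ) - i) / (((i + m : ℕ) : ℂ) + 1 / 2) ^ j - if j = 1 then c m / (m : ℂ) else 0 := by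
    intro m
    have e : ((i + m : ℕ) : ℂ) + 1 / 2 = (i : ℂ) + 1 / 2 + m := by push_cast; ring
    have e' : ((i + m : ℕ) : ℤ) - i = m := by push_cast; ring
    rw [e, e', kerPlus]
    split_ifs <;> ring
  simp only [e1, e3, sum_sub_distrib]
  rw [e2, add_comm L i, sum_range_add]
  split_ifs with h
  · rw [sum_range_succ_div (fun k => c k), show i + L + 1 = L + (i + 1) by ring, sum_range_add]
    ring
  · simp

lemma EHat_add_sum_range_FHatTerm (i j L : ℕ) :
    EHat c (i + 1) j + (-1) ^ j * ∑ k ∈ range L, FHatTerm c i j (k + 1) =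
      ∑ m ∈ range (L + (i + 1)), c m * kerMinus j i m -
        if j = 1 then ∑ r ∈ range i, c ((L + 1 + r : ℕ) : ℤ) / ((L + 1 + r : ℕ) : ℂ) else 0 := by
  have e1 : ∀ k, (-1) ^ j * FHatTerm c i j (k + 1) =
      c ((i + 1 + k : ℕ) : ℤ) / ((i : ℂ) + 1 / 2 - (i + 1 + k : ℕ)) ^ j +
      if j = 1 then c ((k + 1 : ℕ) : ℤ) / ((k + 1 : ℕ) : ℂ) else 0 := by
    intro k
    have e : (i : ℂ) + 1 / 2 - (i + 1 + k : ℕ) = -(((k + 1 : ℕ) : ℂ) - 1 / 2) := by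
      push_cast; ring
    have e' : ((i + 1 + k : ℕ) : ℤ) = ((k + 1 : ℕ) : ℤ) + i := by push_cast; ring
    rw [e, e', neg_pow (((k + 1 : ℕ) : ℂ) - 1 / 2)]
    unfold FHatTerm
    split_ifs with h
    · subst h
      rw [pow_one, pow_one, neg_one_mul, neg_one_mul, div_neg]; ring
    · rcases neg_one_pow_eq_or ℂ j with h | h <;> rw [h]
      · rw [one_mul, one_mul, add_zero]
      · rw [neg_one_mul, neg_one_mul, div_neg, add_zero]
  have e2 : EHat c (i + 1) j = ∑ m ∈ range (i + 1), c m / ((i : ℂ) + 1 / 2 - m) ^ j := by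
    unfold EHat
    rw [← sum_range_reflect, sum_Icc_one_eq_sum_range]
    refine sum_congr rfl fun k hk => ?_
    have hk' : k ≤ i := Nat.lt_succ_iff.1 (mem_range.1 hk)
    rw [show i + 1 - 1 - k = i - k by omega]
    congr 2
    · push_cast [hk']; ring
    · push_cast [hk']; ring
  have e3 : ∀ m : ℕ, c m * kerMinus j i m = c m / ((i : ℂ) + 1 / 2 - m) ^ j +
      if j = 1 then c m / (m : ℂ) else 0 := by
    intro m
    rw [kerMinus]
    split_ifs <;> ring
  rw [mul_sum]
  simp only [e1, e3, sum_add_distrib]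
  rw [e2, add_comm L (i + 1), sum_range_add _ (i + 1) L]
  split_ifs with h
  · rw [sum_range_succ_div (fun k => c k), show i + 1 + L = L + 1 + i by ring,
      sum_range_add _ (L + 1) i]
    ring
  · simp

variable {γ C : ℝ} (hγ : 0 ≤ γ) (hγ1 : γ < 1) (hc : ∀ m : ℕ, ‖c m‖ ≤ C * ((m : ℝ) + 1) ^ γ)

include hγ1 hc in
lemma tendsto_div_nat : Tendsto (fun m : ℕ => c m / (m : ℂ)) atTop (𝓝 0) := by
  have h1 : Tendsto (fun m : ℕ => C * 2 * ((m : ℝ) + 1) ^ (-(1 - γ))) atTop (𝓝 0) := by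
    have h := (tendsto_rpow_neg_atTop (sub_pos.2 hγ1)).comp
      (tendsto_atTop_add_const_right atTop (1 : ℝ) tendsto_natCast_atTop_atTop)
    simpa using h.const_mul (C * 2)
  refine squeeze_zero_norm' ?_ h1
  filter_upwards [eventually_ge_atTop 1] with m hm
  have hm' : (1 : ℝ) ≤ m := by exact_mod_cast hm
  rw [norm_div, Complex.norm_natCast, div_le_iff₀ (by linarith)]
  refine (hc m).trans ?_
  have hC : 0 ≤ C := by simpa using (norm_nonneg _).trans (hc 0)
  have e : ((m : ℝ) + 1) ^ γ = ((m : ℝ) + 1) ^ (-(1 - γ)) * (m + 1) := by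
    rw [← Real.rpow_add_one (by positivity)]; ring_nf
  rw [e, mul_assoc C, mul_assoc C]
  refine mul_le_mul_of_nonneg_left ?_ hC
  nlinarith [Real.rpow_nonneg (by positivity : 0 ≤ (m : ℝ) + 1) (-(1 - γ))]

include hγ1 hc in
lemma tendsto_sum_range_div_nat (j s r : ℕ) :
    Tendsto (fun L : ℕ => if j = 1 then
      ∑ r ∈ range r, c ((L + s + r : ℕ) : ℤ) / ((L + s + r : ℕ) : ℂ) else 0) atTop (𝓝 0) := by
  split_ifs
  · rw [← sum_const_zero (s := range r) (M := ℂ)]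
    refine tendsto_finsetSum _ fun r _ => ?_
    simp only [add_assoc]
    exact (tendsto_div_nat hγ1 hc).comp (tendsto_add_atTop_nat (s + r))
  · exact tendsto_const_nhds

include hγ hγ1 hc in
lemma summable_mul_kerPlus {j : ℕ} (hj : 0 < j) (i : ℕ) :
    Summable fun m : ℕ => c m * kerPlus j i m :=
  summable_mul_ker hγ hγ1 hc (fun n m => norm_kerPlus_le hj n m) i

include hγ hγ1 hc in
lemma summable_mul_kerMinus {j : ℕ} (hj : 0 < j) (i : ℕ) :
    Summable fun m : ℕ => c m * kerMinus j i m :=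
  summable_mul_ker hγ hγ1 hc (fun n m => norm_kerMinus_le hj n m) i

include hγ hγ1 hc in
lemma tendsto_sum_FTildeTerm {j : ℕ} (hj : 0 < j) (i : ℕ) :
    Tendsto (fun K => ∑ k ∈ range K, FTildeTerm c (i + 1) j (k + 1)) atTop
      (𝓝 (ETilde c i j + ∑' m : ℕ, c m * kerPlus j i m)) := by
  rw [← tendsto_add_atTop_iff_nat i]
  simp only [sum_range_FTildeTerm]
  have h := tendsto_sum_range_div_nat hγ1 hc j 0 (i + 1)
  simpa using ((summable_mul_kerPlus hγ hγ1 hc hj i).hasSum.tendsto_sum_nat.const_add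
    (ETilde c i j)).sub h

include hγ hγ1 hc in
lemma tendsto_sum_FHatTerm {j : ℕ} (hj : 0 < j) (i : ℕ) :
    Tendsto (fun K => ∑ k ∈ range K, FHatTerm c i j (k + 1)) atTop
      (𝓝 ((-1) ^ j * (∑' m : ℕ, c m * kerMinus j i m - EHat c (i + 1) j))) := by
  have h := tendsto_sum_range_div_nat hγ1 hc j 1 i
  have h2 := (summable_mul_kerMinus hγ hγ1 hc hj i).hasSum.tendsto_sum_nat
  rw [← tendsto_add_atTop_iff_nat (i + 1)] at h2
  have h3 := ((h2.sub h).sub_const (EHat c (i + 1) j)).const_mul ((-1) ^ j)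
  rw [sub_zero] at h3
  refine h3.congr fun L => ?_
  rw [← EHat_add_sum_range_FHatTerm, add_sub_cancel_left, ← mul_assoc, ← mul_pow]
  simp

include hγ hγ1 hc in
lemma NBar_eq_tsum {j : ℕ} (hj : 0 < j) (i : ℕ) :
    NBar c (i + 1) j = ∑' m : ℕ, c m * kerPlus j i m := by
  rw [NBar, FTilde, series_eq_of_tendsto (tendsto_sum_FTildeTerm hγ hγ1 hc hj i),
    Nat.add_sub_cancel, add_sub_cancel_left]

include hγ hγ1 hc in
lemma N_eq_tsum {j : ℕ} (hj : 0 < j) (i : ℕ) :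
    N c (i + 1) j = ∑' m : ℕ, c m * kerMinus j i m := by
  rw [N, Nat.add_sub_cancel, FHat, series_eq_of_tendsto (tendsto_sum_FHatTerm hγ hγ1 hc hj i),
    ← mul_assoc, ← mul_pow]
  simp

include hγ hγ1 hc in
lemma S_eq_tsum {j : ℕ} (hj : 0 < j) (i : ℕ) :
    S c (i + 1) j = ∑' m : ℕ, c m * kerSum j i m := by
  have h := ((summable_mul_kerMinus hγ hγ1 hc hj i).hasSum.add
    (summable_mul_kerPlus hγ hγ1 hc hj i).hasSum).sub
    (hasSum_ite_eq 0 (c 0 * (1 / ((i : ℂ) + 1 / 2) ^ j)))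
  have e : ((i + 1 : ℕ) : ℂ) - 1 / 2 = (i : ℂ) + 1 / 2 := by push_cast; ring
  rw [S, N_eq_tsum hγ hγ1 hc hj, NBar_eq_tsum hγ hγ1 hc hj, e, ← mul_one_div, ← h.tsum_eq]
  refine tsum_congr fun m => ?_
  rw [kerSum]
  split_ifs with hm
  · subst hm
    simp only [Nat.cast_zero]
    ring
  · ring

lemma tHatTerm_eq_FTildeTerm (j k : ℕ) : tHatTerm c j k = FTildeTerm c 1 j k := by
  simp [tHatTerm, FTildeTerm]

include hγ hγ1 hc in
lemma tHat_eq_tsum {j : ℕ} (hj : 0 < j) : tHat c j = ∑' m : ℕ, c m * kerPlus j 0 m := by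
  rw [tHat, funext (tHatTerm_eq_FTildeTerm (c := c) j),
    series_eq_of_tendsto (tendsto_sum_FTildeTerm hγ hγ1 hc hj 0)]
  simp [ETilde]

include hγ hγ1 hc in
lemma seriesConverges_FHatTerm {j : ℕ} (hj : 0 < j) (n : ℕ) : SeriesConverges (FHatTerm c n j) :=
  seriesConverges_of_tendsto (tendsto_sum_FHatTerm hγ hγ1 hc hj n)

include hγ hγ1 hc in
lemma seriesConverges_FTildeTerm {j : ℕ} (hj : 0 < j) (n : ℕ) :
    SeriesConverges (FTildeTerm c n j) := by
  cases n with
  | zero =>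
    have e : FTildeTerm c 0 j = FHatTerm c 0 j := by
      funext k; simp [FTildeTerm, FHatTerm]
    exact e ▸ seriesConverges_FHatTerm hγ hγ1 hc hj 0
  | succ n => exact seriesConverges_of_tendsto (tendsto_sum_FTildeTerm hγ hγ1 hc hj n)

include hγ hγ1 hc in
lemma seriesConverges_tHatTerm {j : ℕ} (hj : 0 < j) : SeriesConverges (tHatTerm c j) := by
  rw [funext (tHatTerm_eq_FTildeTerm (c := c) j)]
  exact seriesConverges_FTildeTerm hγ hγ1 hc hj 1

include hγ hγ1 hc in
lemma summable_dTerm {j : ℕ} (hj : 2 ≤ j) : Summable fun m : ℕ => dTerm c j (m + 1) := by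
  have hC : 0 ≤ C := by simpa using (norm_nonneg _).trans (hc 0)
  refine Summable.of_norm_bounded
    ((summable_nat_add_one_rpow_neg (t := 2 - γ) (by linarith)).mul_left (C * 2)) fun m => ?_
  have hm : (0 : ℝ) < (m : ℝ) + 1 := by positivity
  have h1 : ‖c ((m + 1 : ℕ) : ℤ)‖ ≤ C * (2 * ((m : ℝ) + 1) ^ γ) := by
    refine (hc (m + 1)).trans (mul_le_mul_of_nonneg_left ?_ hC)
    calc (((m + 1 : ℕ) : ℝ) + 1) ^ γ ≤ (2 * ((m : ℝ) + 1)) ^ γ := by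
          refine Real.rpow_le_rpow (by positivity) ?_ hγ
          push_cast
          linarith [(m.cast_nonneg : (0 : ℝ) ≤ m)]
      _ = 2 ^ γ * ((m : ℝ) + 1) ^ γ := Real.mul_rpow (by norm_num) hm.le
      _ ≤ 2 * ((m : ℝ) + 1) ^ γ := by
          refine mul_le_mul_of_nonneg_right ?_ (by positivity)
          simpa using Real.rpow_le_rpow_of_exponent_le (one_le_two : (1 : ℝ) ≤ 2) hγ1.le
  have e : ‖((m + 1 : ℕ) : ℂ)‖ = (m : ℝ) + 1 := by rw [Complex.norm_natCast]; push_cast; rfl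
  rw [dTerm, norm_div, norm_pow, e, div_le_iff₀ (by positivity)]
  calc _ ≤ C * (2 * ((m : ℝ) + 1) ^ γ) := h1
    _ = C * 2 * ((m : ℝ) + 1) ^ (-(2 - γ)) * ((m : ℝ) + 1) ^ 2 := by
        rw [mul_assoc (C * 2), ← Real.rpow_natCast _ 2, ← Real.rpow_add hm]
        ring_nf
    _ ≤ C * 2 * ((m : ℝ) + 1) ^ (-(2 - γ)) * ((m : ℝ) + 1) ^ j := by
        refine mul_le_mul_of_nonneg_left (pow_le_pow_right₀ (by linarith) hj) (by positivity)

end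

end ParametricEuler

/-! ### The relation -/

namespace ParametricEuler

open Finset Filter Topology

lemma norm_div_pow_le {c x : ℂ} {γ C : ℝ} {q e n : ℕ} (hc : ‖c‖ ≤ C * ((n : ℝ) + 1) ^ γ)
    (hx : ((n : ℝ) + 1) / 2 ≤ ‖x‖) (he : q ≤ e) :
    ‖c / x ^ e‖ ≤ C * 2 ^ e * ((n : ℝ) + 1) ^ (-((q : ℝ) - γ)) := by
  have hn : (0 : ℝ) < (n : ℝ) + 1 := by positivity
  have hC : 0 ≤ C := nonneg_of_mul_nonneg_left ((norm_nonneg c).trans hc) (by positivity)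
  have hx0 : 0 < ‖x‖ := by linarith
  rw [norm_div, norm_pow, div_le_iff₀ (by positivity)]
  refine hc.trans ?_
  have h1 : ((n : ℝ) + 1) ^ q ≤ 2 ^ e * ‖x‖ ^ e := by
    calc ((n : ℝ) + 1) ^ q ≤ ((n : ℝ) + 1) ^ e :=
          pow_le_pow_right₀ (by linarith [(n.cast_nonneg : (0 : ℝ) ≤ n)]) he
      _ ≤ (2 * ‖x‖) ^ e := pow_le_pow_left₀ hn.le (by linarith) e
      _ = _ := mul_pow _ _ _
  calc C * ((n : ℝ) + 1) ^ γ = C * ((n : ℝ) + 1) ^ (-((q : ℝ) - γ)) * ((n : ℝ) + 1) ^ q := by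
        rw [mul_assoc C, ← Real.rpow_natCast _ q, ← Real.rpow_add hn]; ring_nf
    _ ≤ C * ((n : ℝ) + 1) ^ (-((q : ℝ) - γ)) * (2 ^ e * ‖x‖ ^ e) :=
        mul_le_mul_of_nonneg_left h1 (by positivity)
    _ = _ := by ring

/-- Separating the zeroth column of an absolutely convergent double sum. -/
lemma hasSum_prod_swap_succ {F : ℕ × ℕ → ℂ} (hF : Summable F) :
    HasSum (fun x : ℕ × ℕ => F (x.2, x.1 + 1)) (∑' x, F x - ∑' n, F (n, 0)) := by
  have hG : Summable fun x : ℕ × ℕ => F (x.1, x.2 + 1) :=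
    hF.comp_injective (i := fun x : ℕ × ℕ => (x.1, x.2 + 1)) (by
      rintro ⟨n, m⟩ ⟨n', m'⟩ h
      simpa using h)
  have h0 : Summable fun n => F (n, 0) :=
    hF.comp_injective (i := fun n : ℕ => (n, 0)) (fun n n' h => by simpa using h)
  have e : ∑' x, F x = ∑' n, F (n, 0) + ∑' x : ℕ × ℕ, F (x.1, x.2 + 1) := by
    rw [hF.tsum_prod, hG.tsum_prod, ← h0.tsum_add hG.prod]
    exact tsum_congr fun n => (hF.prod_factor n).tsum_eq_zero_add
  rw [e, add_sub_cancel_left]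
  exact (Equiv.prodComm ℕ ℕ).hasSum_iff.2 hG.hasSum

/-- The regularizing terms `1/m` survive only for `p = 1` and even `q`, in the summand `j = q/2`. -/
lemma sum_regularization (y : ℂ) {p q : ℕ} (hp : 0 < p) (hq : 1 < q) :
    ∑ j ∈ Icc 1 (q / 2), ((p + q - 2 * j - 1).choose (p - 1) : ℂ) *
      (1 / y ^ (2 * j) * if p + q - 2 * j = 1 then 1 else 0) =
      if p = 1 ∧ Even q then 1 / y ^ q else 0 := by
  split_ifs with h
  · obtain ⟨rfl, r, rfl⟩ := h
    rw [sum_eq_single r]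
    · rw [if_pos (by omega), show 2 * r = r + r by ring]
      simp
    · intro j _ hj
      rw [if_neg (by omega), mul_zero, mul_zero]
    · intro hr
      exact absurd (mem_Icc.2 ⟨by omega, by omega⟩) hr
  · refine sum_eq_zero fun j hj => ?_
    have hj' := mem_Icc.1 hj
    rw [if_neg, mul_zero, mul_zero]
    intro h2
    exact h ⟨by omega, j, by omega⟩

/-- The relation for the pair `(a_{i+1}, b_m)`. -/
lemma kernel_relation (i m : ℕ) {p q : ℕ} (hp : 0 < p) (hq : 1 < q) :
    (-1) ^ (p + q) * (kerPlus p (i + 1) m / ((i + 1 : ℕ) : ℂ) ^ q)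
      + kerMinus p i m / ((i + 1 : ℕ) : ℂ) ^ q
      - (-1) ^ p * ∑ k ∈ range p, ((p + q - k - 2).choose (q - 1) : ℂ) *
          (kerSum (k + 1) m (i + 1) / ((m : ℂ) + 1 / 2) ^ (p + q - k - 1))
      - 2 * (-1) ^ p * ∑ j ∈ Icc 1 (q / 2), ((p + q - 2 * j - 1).choose (p - 1) : ℂ) *
          (1 / ((i + 1 : ℕ) : ℂ) ^ (2 * j) * kerPlus (p + q - 2 * j) 0 m) = 0 := by
  have hr := residue_sum_eq_zero (x := (m : ℂ) + 1 / 2) (y := ((i + 1 : ℕ) : ℂ))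
    (nat_add_half_ne_zero m) (Nat.cast_ne_zero.2 i.succ_ne_zero)
    (nat_add_half_sub_ne_zero m (i + 1)) (nat_add_half_add_ne_zero m (i + 1)) hp
    (zero_lt_one.trans hq)
  have hs := sum_regularization ((i + 1 : ℕ) : ℂ) hp hq
  have e1 : kerPlus p (i + 1) m = 1 / ((m : ℂ) + 1 / 2 + (i + 1 : ℕ)) ^ p -
      if p = 1 then 1 / (m : ℂ) else 0 := by
    rw [kerPlus]; congr 3; ring
  have e2 : kerMinus p i m = 1 / (((i + 1 : ℕ) : ℂ) - ((m : ℂ) + 1 / 2)) ^ p +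
      if p = 1 then 1 / (m : ℂ) else 0 := by
    rw [kerMinus]; congr 3; push_cast; ring
  have e3 : ∑ j ∈ Icc 1 (q / 2), ((p + q - 2 * j - 1).choose (p - 1) : ℂ) *
        (1 / ((i + 1 : ℕ) : ℂ) ^ (2 * j) * kerPlus (p + q - 2 * j) 0 m) =
      ∑ j ∈ Icc 1 (q / 2), ((p + q - 2 * j - 1).choose (p - 1) : ℂ) *
          (1 / ((i + 1 : ℕ) : ℂ) ^ (2 * j) / ((m : ℂ) + 1 / 2) ^ (p + q - 2 * j)) -
      (∑ j ∈ Icc 1 (q / 2), ((p + q - 2 * j - 1).choose (p - 1) : ℂ) *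
        (1 / ((i + 1 : ℕ) : ℂ) ^ (2 * j) * if p + q - 2 * j = 1 then 1 else 0)) * (1 / m) := by
    rw [sum_mul, ← sum_sub_distrib]
    refine sum_congr rfl fun j _ => ?_
    rw [kerPlus, show ((0 : ℕ) : ℂ) + 1 / 2 + m = m + 1 / 2 by push_cast; ring]
    split_ifs <;> ring
  simp only [kerSum_succ]
  rw [e1, e2, e3, hs]
  by_cases hp1 : p = 1
  · subst hp1
    rcases Nat.even_or_odd q with h | h
    · simp only [h, if_true, and_self, pow_add, h.neg_one_pow] at hr ⊢
      linear_combination hr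
    · have h' : ¬ Even q := Nat.not_even_iff_odd.2 h
      simp only [h', if_true, if_false, and_false, pow_add, h.neg_one_pow] at hr ⊢
      linear_combination hr
  · simp only [hp1, if_false, false_and] at hr ⊢
    linear_combination hr

end ParametricEuler

theorem theorem3p2 (a b : ℤ → ℂ) (α β : ℝ) (hα : α < 1) (hβ : β < 1)
    (ha : ParametricEuler.GrowthLittleO a α) (hb : ParametricEuler.GrowthLittleO b β)
    (p q : ℕ) (hp : 0 < p) (hq : 1 < q) (hαβ : α + β < (q : ℝ) - 1) :
    -- the series defining the constants converge
    (∀ j : ℕ, 2 ≤ j → ParametricEuler.SeriesConverges (ParametricEuler.dTerm a j)) ∧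
    (∀ c ∈ ({a, b} : Set (ℤ → ℂ)), ∀ j : ℕ, 1 ≤ j →
      ParametricEuler.SeriesConverges (ParametricEuler.tHatTerm c j) ∧
      ∀ n : ℕ, ParametricEuler.SeriesConverges (ParametricEuler.FHatTerm c n j) ∧
        ParametricEuler.SeriesConverges (ParametricEuler.FTildeTerm c n j)) ∧
    -- the sums in the relation converge absolutely
    Summable (fun m : ℕ => ParametricEuler.barTerm a b p q (m + 1)) ∧
    Summable (fun m : ℕ => ParametricEuler.plainTerm a b p q (m + 1)) ∧
    (∀ k : ℕ, k < p → Summable (fun m : ℕ => ParametricEuler.halfTerm a b p q k (m + 1))) ∧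
    -- the relation
    (-1 : ℂ) ^ (p + q) * ParametricEuler.series (ParametricEuler.barTerm a b p q)
      + ParametricEuler.series (ParametricEuler.plainTerm a b p q)
      - (-1 : ℂ) ^ p * ∑ k ∈ Finset.range p, ((p + q - k - 2).choose (q - 1) : ℂ) *
          ParametricEuler.series (ParametricEuler.halfTerm a b p q k)
      + a 0 * (-1 : ℂ) ^ p * ((p + q - 1).choose q : ℂ) * ParametricEuler.tHat b (p + q)
      - 2 * (-1 : ℂ) ^ p * ∑ j ∈ Finset.Icc 1 (q / 2),
          ((p + q - 2 * j - 1).choose (p - 1) : ℂ) *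
            ParametricEuler.D a (2 * j) * ParametricEuler.tHat b (p + q - 2 * j)
      = 0 := by
  open ParametricEuler Finset in
  -- The exponents may be taken nonnegative: since `q ≥ 2`, this preserves their bounds.
  obtain ⟨α', hα0, hα1, hαα⟩ : ∃ α' : ℝ, 0 ≤ α' ∧ α' < 1 ∧ α' = max α 0 :=
    ⟨max α 0, le_max_right _ _, max_lt hα one_pos, rfl⟩
  obtain ⟨β', hβ0, hβ1, hββ⟩ : ∃ β' : ℝ, 0 ≤ β' ∧ β' < 1 ∧ β' = max β 0 :=
    ⟨max β 0, le_max_right _ _, max_lt hβ one_pos, rfl⟩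
  have hq2 : (2 : ℝ) ≤ q := by exact_mod_cast hq
  have hsum : α' + β' < (q : ℝ) - 1 := by
    rcases max_cases α 0 with ⟨h, _⟩ | ⟨h, _⟩ <;> rcases max_cases β 0 with ⟨h', _⟩ | ⟨h', _⟩ <;>
      rw [hαα, hββ, h, h'] <;> linarith
  obtain ⟨Ca, hCa, hca⟩ := ha.exists_bound (hαα ▸ le_max_left α 0) hα0
  obtain ⟨Cb, hCb, hcb⟩ := hb.exists_bound (hββ ▸ le_max_left β 0) hβ0
  have hu : ∀ n : ℕ, ‖a n / (n : ℂ) ^ q‖ ≤ Ca * 2 ^ q * ((n : ℝ) + 1) ^ (-((q : ℝ) - α')) := by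
    intro n
    rcases n.eq_zero_or_pos with rfl | hn
    · rw [Nat.cast_zero, Nat.cast_zero, zero_pow (by omega), div_zero, norm_zero]
      positivity
    · have hn' : (1 : ℝ) ≤ n := by exact_mod_cast hn
      exact norm_div_pow_le (hca n) (by rw [Complex.norm_natCast]; linarith) le_rfl
  have hu' : ∀ n : ℕ, ‖a ((n + 1 : ℕ) : ℤ) / ((n + 1 : ℕ) : ℂ) ^ q‖ ≤
      Ca * 2 ^ q * ((n : ℝ) + 1) ^ (-((q : ℝ) - α')) := fun n =>
    (hu (n + 1)).trans (mul_le_mul_of_nonneg_left (Real.rpow_le_rpow_of_nonpos (by positivity)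
      (by push_cast; linarith) (by linarith)) (by positivity))
  have hv : ∀ e, q ≤ e → ∀ n : ℕ, ‖b n / ((n : ℂ) + 1 / 2) ^ e‖ ≤
      Cb * 2 ^ e * ((n : ℝ) + 1) ^ (-((q : ℝ) - β')) := fun e he n =>
    norm_div_pow_le (hcb n)
      (by rw [norm_nat_add_half]; linarith [(n.cast_nonneg : (0 : ℝ) ≤ n)]) he
  -- The double series underlying the three kinds of sums converge absolutely.
  have hF1 : Summable fun x : ℕ × ℕ => a ((x.1 + 1 : ℕ) : ℤ) / ((x.1 + 1 : ℕ) : ℂ) ^ q *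
      (b x.2 * kerPlus p (x.1 + 1) x.2) := by
    have h := summable_mul_mul_ker (u := fun n => a n / (n : ℂ) ^ q) (c := fun m => b m) hβ0 hβ1
      (by linarith) hu hcb (norm_kerPlus_le hp)
    exact h.comp_injective (i := fun x : ℕ × ℕ => (x.1 + 1, x.2)) (by
      rintro ⟨n, m⟩ ⟨n', m'⟩ h
      simpa using h)
  have hF2 : Summable fun x : ℕ × ℕ => a ((x.1 + 1 : ℕ) : ℤ) / ((x.1 + 1 : ℕ) : ℂ) ^ q *
      (b x.2 * kerMinus p x.1 x.2) :=
    summable_mul_mul_ker (u := fun n => a ((n + 1 : ℕ) : ℤ) / ((n + 1 : ℕ) : ℂ) ^ q)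
      (c := fun m => b m) hβ0 hβ1 (by linarith) hu' hcb (norm_kerMinus_le hp)
  have hF3 : ∀ k, k < p → Summable fun x : ℕ × ℕ =>
      b x.1 / ((x.1 : ℂ) + 1 / 2) ^ (p + q - k - 1) * (a x.2 * kerSum (k + 1) x.1 x.2) :=
    fun k hk => summable_mul_mul_ker (u := fun n => b n / ((n : ℂ) + 1 / 2) ^ (p + q - k - 1))
      (c := fun m => a m) hα0 hα1 (by linarith) (hv _ (by omega)) hca
      (norm_kerSum_le k.succ_pos)
  have hD : ∀ j, 2 ≤ j → Summable fun m : ℕ => dTerm a j (m + 1) :=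
    fun j hj => summable_dTerm hα0 hα1 hca hj
  have e1 : ∀ i : ℕ, barTerm a b p q (i + 1) =
      ∑' m : ℕ, a ((i + 1 : ℕ) : ℤ) / ((i + 1 : ℕ) : ℂ) ^ q * (b m * kerPlus p (i + 1) m) := by
    intro i
    rw [tsum_mul_left, ← NBar_eq_tsum hβ0 hβ1 hcb hp, barTerm]
    ring
  have e2 : ∀ i : ℕ, plainTerm a b p q (i + 1) =
      ∑' m : ℕ, a ((i + 1 : ℕ) : ℤ) / ((i + 1 : ℕ) : ℂ) ^ q * (b m * kerMinus p i m) := by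
    intro i
    rw [tsum_mul_left, ← N_eq_tsum hβ0 hβ1 hcb hp, plainTerm]
    ring
  have e3 : ∀ k i : ℕ, halfTerm a b p q k (i + 1) = ∑' m : ℕ,
      b i / ((i : ℂ) + 1 / 2) ^ (p + q - k - 1) * (a m * kerSum (k + 1) i m) := by
    intro k i
    rw [tsum_mul_left, ← S_eq_tsum hα0 hα1 hca k.succ_pos, halfTerm,
      show ((i + 1 : ℕ) : ℤ) - 1 = i by push_cast; ring,
      show ((i + 1 : ℕ) : ℂ) - 1 / 2 = i + 1 / 2 by push_cast; ring]
    ring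
  have s1 : Summable fun i : ℕ => barTerm a b p q (i + 1) := by
    simpa only [e1] using hF1.prod
  have s2 : Summable fun i : ℕ => plainTerm a b p q (i + 1) := by
    simpa only [e2] using hF2.prod
  have s3 : ∀ k, k < p → Summable fun i : ℕ => halfTerm a b p q k (i + 1) := by
    intro k hk
    simpa only [e3] using (hF3 k hk).prod
  refine ⟨fun j hj => seriesConverges_of_summable (hD j hj), ?_, s1, s2, s3, ?_⟩
  · rintro c (rfl | rfl) j hj
    · exact ⟨seriesConverges_tHatTerm hα0 hα1 hca hj, fun n =>
        ⟨seriesConverges_FHatTerm hα0 hα1 hca hj n, seriesConverges_FTildeTerm hα0 hα1 hca hj n⟩⟩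
    · exact ⟨seriesConverges_tHatTerm hβ0 hβ1 hcb hj, fun n =>
        ⟨seriesConverges_FHatTerm hβ0 hβ1 hcb hj n, seriesConverges_FTildeTerm hβ0 hβ1 hcb hj n⟩⟩
  have t1 := hF1.hasSum
  rw [hF1.tsum_prod, tsum_congr fun i => (e1 i).symm, ← series_eq_tsum s1] at t1
  have t2 := hF2.hasSum
  rw [hF2.tsum_prod, tsum_congr fun i => (e2 i).symm, ← series_eq_tsum s2] at t2
  have t3 : ∀ k ∈ range p, HasSum (fun x : ℕ × ℕ =>
      b x.2 / ((x.2 : ℂ) + 1 / 2) ^ (p + q - k - 1) *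
        (a ((x.1 + 1 : ℕ) : ℤ) * kerSum (k + 1) x.2 (x.1 + 1)))
      (series (halfTerm a b p q k) - a 0 * tHat b (p + q)) := by
    intro k hk
    have hk' := mem_range.1 hk
    have h := hasSum_prod_swap_succ (hF3 k hk')
    rw [(hF3 k hk').tsum_prod, tsum_congr fun i => (e3 k i).symm, ← series_eq_tsum (s3 k hk')] at h
    convert h using 2
    rw [tHat_eq_tsum hβ0 hβ1 hcb (by omega), ← tsum_mul_left]
    refine tsum_congr fun n => ?_
    have e : ((n : ℂ) + 1 / 2) ^ (p + q) =
        ((n : ℂ) + 1 / 2) ^ (p + q - k - 1) * ((n : ℂ) + 1 / 2) ^ (k + 1) := by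
      rw [← pow_add]; congr 1; omega
    rw [kerSum_zero, kerPlus, if_neg (by omega),
      show ((0 : ℕ) : ℂ) + 1 / 2 + n = n + 1 / 2 by push_cast; ring, e]
    simp only [Nat.cast_zero]
    have := nat_add_half_ne_zero n
    field_simp
    ring
  have t4 : ∀ j ∈ Icc 1 (q / 2), HasSum (fun x : ℕ × ℕ =>
      dTerm a (2 * j) (x.1 + 1) * (b x.2 * kerPlus (p + q - 2 * j) 0 x.2))
      (D a (2 * j) * tHat b (p + q - 2 * j)) := by
    intro j hj
    have hj' := mem_Icc.1 hj
    have hd := hD (2 * j) (by omega)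
    have ht := summable_mul_kerPlus hβ0 hβ1 hcb (j := p + q - 2 * j) (by omega) 0
    rw [D, if_neg (by omega), series_eq_tsum hd, tHat_eq_tsum hβ0 hβ1 hcb (by omega),
      tsum_mul_tsum_of_summable_norm hd.norm ht.norm]
    exact (summable_mul_of_summable_norm hd.norm ht.norm).hasSum
  have T := (((t1.mul_left ((-1 : ℂ) ^ (p + q))).add t2).sub ((hasSum_sum fun k hk =>
      (t3 k hk).mul_left ((p + q - k - 2).choose (q - 1) : ℂ)).mul_left ((-1 : ℂ) ^ p))).sub
    ((hasSum_sum fun j hj => (t4 j hj).mul_left ((p + q - 2 * j - 1).choose (p - 1) : ℂ)).mul_left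
      (2 * (-1 : ℂ) ^ p))
  have Z := T.unique (hasSum_zero.congr_fun ?_)
  · have hc : ∑ k ∈ range p, ((p + q - k - 2).choose (q - 1) : ℂ) = ((p + q - 1).choose q : ℂ) := by
      exact_mod_cast sum_choose_eq (p := p) (zero_lt_one.trans hq)
    simp only [mul_sub, sum_sub_distrib, ← sum_mul, hc, ← mul_assoc] at Z ⊢
    linear_combination Z
  · intro x
    have h := kernel_relation x.1 x.2 hp hq
    have e3 : ∑ k ∈ range p, ((p + q - k - 2).choose (q - 1) : ℂ) *
        (b x.2 / ((x.2 : ℂ) + 1 / 2) ^ (p + q - k - 1) *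
          (a ((x.1 + 1 : ℕ) : ℤ) * kerSum (k + 1) x.2 (x.1 + 1))) =
        a ((x.1 + 1 : ℕ) : ℤ) * b x.2 * ∑ k ∈ range p, ((p + q - k - 2).choose (q - 1) : ℂ) *
          (kerSum (k + 1) x.2 (x.1 + 1) / ((x.2 : ℂ) + 1 / 2) ^ (p + q - k - 1)) := by
      rw [mul_sum]
      exact sum_congr rfl fun k _ => by ring
    have e4 : ∑ j ∈ Icc 1 (q / 2), ((p + q - 2 * j - 1).choose (p - 1) : ℂ) *
        (dTerm a (2 * j) (x.1 + 1) * (b x.2 * kerPlus (p + q - 2 * j) 0 x.2)) =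
        a ((x.1 + 1 : ℕ) : ℤ) * b x.2 *
          ∑ j ∈ Icc 1 (q / 2), ((p + q - 2 * j - 1).choose (p - 1) : ℂ) *
          (1 / ((x.1 + 1 : ℕ) : ℂ) ^ (2 * j) * kerPlus (p + q - 2 * j) 0 x.2) := by
      rw [mul_sum]
      exact sum_congr rfl fun j _ => by rw [dTerm]; ring
    rw [e3, e4]
    linear_combination (a ((x.1 + 1 : ℕ) : ℤ) * b x.2) * h
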